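/- **Proposition 4.2.** Let $k$ be an arbitrary field and let $(\Gamma,\Lambda)$ be a finite quiver (multiple arrows allowed) without oriented cycles, whose underlying graph $\Gamma$ is connected and has more than one vertex. Write $k(\Gamma,\Lambda)$ for its path algebra. A left $k(\Gamma,\Lambda)$-module $M$ of finite $k$-dimension is identified as usual with the representation $(V,f)$ in which $V(x)=e_xM$ for each vertex $x$, where $e_x$ is the path of length $0$ at $x$, and each arrow $a:x\to y$ gives the map $f_a:V(x)\to V(y)$, $v\mapsto av$. The dimension vector of $M$ is $\dim M=(\dim_k V(x))_x$. For a sink $x$ of $(\Gamma,\Lambda)$, that is, a vertex at which no arrow starts, let $\sigma_x\Lambda$ be the orientation obtained by reversing all arrows incident with $x$. The positive reflection functor $F_x^+$ sends a representation $(V,f)$ of $(\Gamma,\Lambda)$ to the representation $(W,g)$ of $(\Gamma,\sigma_x\Lambda)$ with $W(z)=V(z)$ for $z\neq x$ and $$W(x)=\operatorname{Ker}\Big(\bigoplus_{a:\,y\to x}V(y)\xrightarrow{\,(f_a)_a\,}V(x)\Big),$$ where $g_b=f_b$ for the arrows $b$ not incident with $x$, and the reversal of an arrow $a:y\to x$ acts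 as the projection $W(x)\to V(y)$ onto the component of $a$. A finite, possibly empty, sequence of vertices $S=x_1,\dots,x_s$ is $(+)$-admissible if $x_1$ is a sink with respect to $\Lambda$, $x_2$ is a sink with respect to $\sigma_{x_1}\Lambda$, and so on. The module $M$ is preprojective if $F_{x_s}^+\cdots F_{x_1}^+M=0$ for some $(+)$-admissible sequence $x_1,\dots,x_s$. Let $M$ and $N$ be indecomposable left $k(\Gamma,\Lambda)$-modules of finite $k$-dimension. If $M$ is preprojective and $\dim M=\dim N$, then $M\cong N$. -/

import Mathlib

universe u v w

/-! ### The path algebra of a quiver with finitely many vertices -/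

/-- The paths of a quiver (including the paths of length `0`), with arbitrary endpoints:
`⟨x, y, p⟩` is the path `p` from `x` to `y`. -/
abbrev QuiverPath (V : Type*) [Quiver V] := Σ x y : V, Quiver.Path x y

/-- The underlying vector space of the path algebra: the free `k`-module on the paths. -/
def PathAlgebra (k : Type*) [Field k] (V : Type*) [Quiver V] := QuiverPath V →₀ k

namespace PathAlgebra

noncomputable section

variable {k : Type*} [Field k] {V : Type*} [Quiver V]

instance : AddCommGroup (PathAlgebra k V) := inferInstanceAs (AddCommGroup (QuiverPath V →₀ k))

instance : Module k (PathAlgebra k V) := inferInstanceAs (Module k (QuiverPath V →₀ k))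

/-- The basis element of the path algebra given by a path. -/
def ofPath (k : Type*) [Field k] (p : QuiverPath V) : PathAlgebra k V :=
  (Finsupp.single p 1 : QuiverPath V →₀ k)

open Classical in
/-- The product of the paths `p` and `q`: the path that first runs through `q` and then
through `p` if `q` ends where `p` starts, and `0` otherwise. -/
def mulPath (k : Type*) [Field k] (p q : QuiverPath V) : PathAlgebra k V :=
  if h : q.2.1 = p.1 then ofPath k ⟨q.1, p.2.1, (h ▸ q.2.2 : Quiver.Path q.1 p.1).comp p.2.2⟩
  else 0

/-- The bilinear extension of the product of paths. -/
def mulLin (k : Type*) [Field k] (V : Type*) [Quiver V] :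
    PathAlgebra k V →ₗ[k] PathAlgebra k V →ₗ[k] PathAlgebra k V :=
  Finsupp.linearCombination k (M := PathAlgebra k V →ₗ[k] PathAlgebra k V)
    (fun p => Finsupp.linearCombination k (M := PathAlgebra k V) (fun q => mulPath k p q))

instance : Mul (PathAlgebra k V) := ⟨fun a b => mulLin k V a b⟩

/-- The unit: the sum of the paths of length `0`. -/
instance [Fintype V] : One (PathAlgebra k V) :=
  ⟨∑ x : V, ofPath k ⟨x, x, Quiver.Path.nil⟩⟩

theorem mul_def (a b : PathAlgebra k V) : a * b = mulLin k V a b := rfl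

theorem one_def [Fintype V] :
    (1 : PathAlgebra k V) = ∑ x : V, ofPath k ⟨x, x, Quiver.Path.nil⟩ := rfl

theorem ofPath_mul_ofPath (p q : QuiverPath V) :
    ofPath k p * ofPath k q = mulPath k p q := by
  rw [mul_def, mulLin, ofPath, ofPath]
  erw [Finsupp.linearCombination_single, one_smul, Finsupp.linearCombination_single, one_smul]

theorem mulPath_comp {x y z : V} (p : Quiver.Path y z) (q : Quiver.Path x y) :
    mulPath k ⟨y, z, p⟩ ⟨x, y, q⟩ = ofPath k ⟨x, z, q.comp p⟩ := by
  simp [mulPath]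

theorem mulPath_ne {p q : QuiverPath V} (h : q.2.1 ≠ p.1) : mulPath k p q = 0 := by
  simp [mulPath, h]

@[elab_as_elim]
theorem induction_on {P : PathAlgebra k V → Prop} (a : PathAlgebra k V) (h0 : P 0)
    (hadd : ∀ a b, P a → P b → P (a + b)) (hp : ∀ (c : k) p, P (c • ofPath k p)) : P a := by
  refine Finsupp.induction_linear (motive := P) a h0 hadd fun p c => ?_
  have := hp c p
  have e : c • ofPath k p = (Finsupp.single p c : QuiverPath V →₀ k) :=
    (Finsupp.smul_single c p (1 : k)).trans (by rw [smul_eq_mul, mul_one])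
  rwa [e] at this

theorem mulPath_assoc (p q r : QuiverPath V) :
    mulLin k V (mulPath k p q) (ofPath k r) = mulLin k V (ofPath k p) (mulPath k q r) := by
  obtain ⟨p1, p2, p⟩ := p
  obtain ⟨q1, q2, q⟩ := q
  obtain ⟨r1, r2, r⟩ := r
  by_cases h : q2 = p1
  · subst h
    by_cases h' : r2 = q1
    · subst h'
      simp only [mulPath_comp, ← mul_def, ofPath_mul_ofPath, Quiver.Path.comp_assoc]
    · rw [mulPath_comp, mulPath_ne (p := ⟨q1, q2, q⟩) (q := ⟨r1, r2, r⟩) h', ← mul_def,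
        ofPath_mul_ofPath, mulPath_ne (by exact h'), map_zero]
  · rw [mulPath_ne (p := ⟨p1, p2, p⟩) (q := ⟨q1, q2, q⟩) h, map_zero, LinearMap.zero_apply]
    by_cases h' : r2 = q1
    · subst h'
      rw [mulPath_comp, ← mul_def, ofPath_mul_ofPath, mulPath_ne (by exact h)]
    · rw [mulPath_ne (p := ⟨q1, q2, q⟩) (q := ⟨r1, r2, r⟩) h', map_zero]

theorem mul_assoc_aux (a b c : PathAlgebra k V) : a * b * c = a * (b * c) := by
  simp only [mul_def]
  induction a using induction_on with
  | h0 => simp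
  | hadd a a' h h' => simp only [map_add, LinearMap.add_apply, h, h']
  | hp s p =>
    induction b using induction_on with
    | h0 => simp
    | hadd b b' h h' => simp only [map_add, LinearMap.add_apply, h, h']
    | hp t q =>
      induction c using induction_on with
      | h0 => simp
      | hadd c c' h h' => simp only [map_add, h, h']
      | hp r x =>
        simp only [map_smul, LinearMap.smul_apply]
        have e1 := ofPath_mul_ofPath (k := k) p q
        have e2 := ofPath_mul_ofPath (k := k) q x
        rw [mul_def] at e1 e2
        rw [e1, e2, mulPath_assoc]

theorem one_mul_aux [Fintype V] (a : PathAlgebra k V) : 1 * a = a := by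
  rw [mul_def]
  induction a using induction_on with
  | h0 => simp
  | hadd a b h h' => rw [map_add, h, h']
  | hp c p =>
    obtain ⟨x, y, p⟩ := p
    rw [map_smul, one_def, map_sum, LinearMap.sum_apply, Finset.sum_eq_single y]
    · rw [← mul_def, ofPath_mul_ofPath, mulPath_comp]; rfl
    · intro z _ hz
      rw [← mul_def, ofPath_mul_ofPath, mulPath_ne (by exact hz.symm)]
    · simp

theorem mul_one_aux [Fintype V] (a : PathAlgebra k V) : a * 1 = a := by
  rw [mul_def]
  induction a using induction_on with
  | h0 => simp
  | hadd a b h h' => rw [map_add, LinearMap.add_apply, h, h']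
  | hp c p =>
    obtain ⟨x, y, p⟩ := p
    rw [map_smul, LinearMap.smul_apply, one_def, map_sum, Finset.sum_eq_single x]
    · rw [← mul_def, ofPath_mul_ofPath, mulPath_comp, Quiver.Path.nil_comp]
    · intro z _ hz
      rw [← mul_def, ofPath_mul_ofPath, mulPath_ne (by exact hz)]
    · simp

instance [Fintype V] : Ring (PathAlgebra k V) :=
  { (inferInstance : AddCommGroup (PathAlgebra k V)),
    (inferInstance : Mul (PathAlgebra k V)),
    (inferInstance : One (PathAlgebra k V)) with
    left_distrib := fun a b c => map_add (mulLin k V a) b c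
    right_distrib := fun a b c => by simp only [mul_def, map_add, LinearMap.add_apply]
    zero_mul := fun a => by simp only [mul_def, map_zero, LinearMap.zero_apply]
    mul_zero := fun a => by simp only [mul_def, map_zero]
    mul_assoc := mul_assoc_aux
    one_mul := one_mul_aux
    mul_one := mul_one_aux }

instance [Fintype V] : Algebra k (PathAlgebra k V) :=
  Algebra.ofModule
    (fun r a b => by simp only [mul_def, map_smul, LinearMap.smul_apply])
    (fun r a b => by simp only [mul_def, map_smul])

/-- The idempotent given by the path of length `0` at the vertex `x`. -/
def vertex (k : Type*) [Field k] (x : V) : PathAlgebra k V :=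
  ofPath k ⟨x, x, Quiver.Path.nil⟩

/-- The element of the path algebra given by an arrow. -/
def arrow (k : Type*) [Field k] {x y : V} (a : x ⟶ y) : PathAlgebra k V :=
  ofPath k ⟨x, y, a.toPath⟩

theorem vertex_mul_arrow [Fintype V] {x y : V} (a : x ⟶ y) :
    vertex k y * arrow k a = arrow k a := by
  rw [vertex, arrow, ofPath_mul_ofPath, mulPath_comp, Quiver.Path.comp_nil]

end

end PathAlgebra

/-! ### Orientations of a graph and admissible sequences -/

/-- A quiver with vertex set `Γ₀` and arrow set `Γ₁`, given by the starting point and the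
endpoint of each arrow. Forgetting the directions of the arrows gives its underlying graph,
with the vertices `Γ₀` and the (possibly multiple) edges `Γ₁`. -/
structure QuiverOrientation (Γ₀ : Type u) (Γ₁ : Type) where
  /-- The starting point of an arrow. -/
  s : Γ₁ → Γ₀
  /-- The endpoint of an arrow. -/
  e : Γ₁ → Γ₀

namespace QuiverOrientation

variable {Γ₀ : Type u} {Γ₁ : Type}

/-- The vertex set `Γ₀`, with the quiver structure given by `Λ`. -/
def Vert (_ : QuiverOrientation Γ₀ Γ₁) : Type u := Γ₀

/-- A vertex of the graph, as a vertex of the quiver given by `Λ`. -/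
def vert (Λ : QuiverOrientation Γ₀ Γ₁) (x : Γ₀) : Λ.Vert := x

/-- The arrows from `x` to `y`. -/
instance (Λ : QuiverOrientation Γ₀ Γ₁) : Quiver Λ.Vert where
  Hom x y := {a : Γ₁ // Λ.s a = x ∧ Λ.e a = y}

/-- An arrow from `x` to `y`, as an arrow of the quiver given by `Λ`. -/
def hom (Λ : QuiverOrientation Γ₀ Γ₁) {x y : Γ₀} (a : Γ₁) (hs : Λ.s a = x) (he : Λ.e a = y) :
    Λ.vert x ⟶ Λ.vert y := ⟨a, hs, he⟩

instance (Λ : QuiverOrientation Γ₀ Γ₁) [h : Fintype Γ₀] : Fintype Λ.Vert := h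

/-- The underlying graph is connected. -/
def IsConnected (Λ : QuiverOrientation Γ₀ Γ₁) : Prop :=
  (SimpleGraph.fromRel fun x y : Γ₀ => ∃ a, Λ.s a = x ∧ Λ.e a = y).Connected

/-- There are no oriented cycles: every path from a vertex to itself has length `0`.
In particular there are no loops. -/
def IsAcyclic (Λ : QuiverOrientation Γ₀ Γ₁) : Prop :=
  ∀ (x : Λ.Vert) (p : Quiver.Path x x), p.length = 0

/-- A sink: no arrow starts at `x`. -/
def IsSink (Λ : QuiverOrientation Γ₀ Γ₁) (x : Γ₀) : Prop := ∀ a, Λ.s a ≠ x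

open Classical in
/-- The orientation `σ_x Λ`, obtained by reversing all arrows incident with `x`. -/
noncomputable def reverseAt (Λ : QuiverOrientation Γ₀ Γ₁) (x : Γ₀) :
    QuiverOrientation Γ₀ Γ₁ where
  s a := if Λ.s a = x ∨ Λ.e a = x then Λ.e a else Λ.s a
  e a := if Λ.s a = x ∨ Λ.e a = x then Λ.s a else Λ.e a

/-- The orientation `Λ^S = σ_{x_s} ⋯ σ_{x_1} Λ` for a sequence `S = x_1, …, x_s`. -/
noncomputable def reverseSeq (Λ : QuiverOrientation Γ₀ Γ₁) : List Γ₀ → QuiverOrientation Γ₀ Γ₁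
  | [] => Λ
  | x :: S => (Λ.reverseAt x).reverseSeq S

/-- A `(+)`-admissible sequence `x_1, …, x_s`: the vertex `x_1` is a sink with respect to `Λ`,
`x_2` is a sink with respect to `σ_{x_1} Λ`, and so on. -/
def IsAdmissible (Λ : QuiverOrientation Γ₀ Γ₁) : List Γ₀ → Prop
  | [] => True
  | x :: S => Λ.IsSink x ∧ (Λ.reverseAt x).IsAdmissible S

theorem IsSink.s_ne_of_reverseAt {Λ : QuiverOrientation Γ₀ Γ₁} {x : Γ₀} (hx : Λ.IsSink x)
    {a : Γ₁} (h : (Λ.reverseAt x).s a = x) : Λ.e a = x ∧ (Λ.reverseAt x).e a = Λ.s a := by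
  by_cases h1 : Λ.s a = x ∨ Λ.e a = x
  · simp only [reverseAt, h1, if_true] at h ⊢
    exact ⟨h, trivial⟩
  · simp only [reverseAt, h1, if_false] at h
    exact absurd h (hx a)

theorem IsSink.eq_of_reverseAt {Λ : QuiverOrientation Γ₀ Γ₁} {x : Γ₀} (hx : Λ.IsSink x)
    {a : Γ₁} (h : (Λ.reverseAt x).s a ≠ x) :
    (Λ.reverseAt x).s a = Λ.s a ∧ (Λ.reverseAt x).e a = Λ.e a ∧ Λ.e a ≠ x := by
  by_cases h1 : Λ.s a = x ∨ Λ.e a = x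
  · simp only [reverseAt, h1, if_true] at h
    exact absurd h (by have := hx a; tauto)
  · simp only [reverseAt, h1, if_false]
    tauto

end QuiverOrientation

/-! ### Representations and the positive reflection functors -/

/-- A representation over `k` of the quiver given by `Λ`: finite-dimensional vector spaces
`V x` and linear maps `map a : V x → V y` for the arrows `a : x → y`. -/
structure QuiverRep (k : Type v) [Field k] {Γ₀ : Type u} {Γ₁ : Type}
    (Λ : QuiverOrientation Γ₀ Γ₁) where
  /-- The vector space at a vertex. -/
  V : Γ₀ → ModuleCat.{w} k
  /-- The linear map given by an arrow `a : x → y`. -/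
  map : ∀ {x y : Γ₀} (a : Γ₁), Λ.s a = x → Λ.e a = y → (V x →ₗ[k] V y)
  finite : ∀ x, Module.Finite k (V x)

namespace QuiverRep

noncomputable section

variable {k : Type v} [Field k] {Γ₀ : Type u} {Γ₁ : Type} [Fintype Γ₁]
  {Λ : QuiverOrientation Γ₀ Γ₁}

open Classical in
/-- The map `h : ⨁ V (s a) → V x`, over the arrows `a` ending at `x`, that is induced by the
maps `V (s a) → V x` of the representation. -/
def sumMap (R : QuiverRep.{u, v, w} k Λ) (x : Γ₀) :
    (∀ a : {a : Γ₁ // Λ.e a = x}, R.V (Λ.s a)) →ₗ[k] R.V x :=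
  ∑ a : {a : Γ₁ // Λ.e a = x}, (R.map a.1 rfl a.2).comp (LinearMap.proj a)

open Classical in
/-- The spaces of the reflected representation: `Ker h` at `x`, and `V z` at all other `z`. -/
def reflectV (R : QuiverRep.{u, v, w} k Λ) (x z : Γ₀) : ModuleCat.{w} k :=
  if z = x then ModuleCat.of k (LinearMap.ker (R.sumMap x)) else R.V z

theorem reflectV_self (R : QuiverRep.{u, v, w} k Λ) {x z : Γ₀} (h : z = x) :
    R.reflectV x z = ModuleCat.of k (LinearMap.ker (R.sumMap x)) := if_pos h

theorem reflectV_other (R : QuiverRep.{u, v, w} k Λ) {x z : Γ₀} (h : z ≠ x) :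
    R.reflectV x z = R.V z := if_neg h

/-- The identification of the space at `z = x` with `Ker h`. -/
def reflectSelf (R : QuiverRep.{u, v, w} k Λ) {x z : Γ₀} (h : z = x) :
    R.reflectV x z ≃ₗ[k] LinearMap.ker (R.sumMap x) :=
  (CategoryTheory.eqToIso (R.reflectV_self h)).toLinearEquiv

/-- The identification of the space at `z ≠ x` with `V z`. -/
def reflectOther (R : QuiverRep.{u, v, w} k Λ) {x z : Γ₀} (h : z ≠ x) :
    R.reflectV x z ≃ₗ[k] R.V z :=
  (CategoryTheory.eqToIso (R.reflectV_other h)).toLinearEquiv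

/-- For an arrow `a : y → x`, the map `Ker h → V y` induced by the inclusion of `Ker h`. -/
def kerProj (R : QuiverRep.{u, v, w} k Λ) {x y : Γ₀} (a : Γ₁) (hs : Λ.s a = y)
    (he : Λ.e a = x) : LinearMap.ker (R.sumMap x) →ₗ[k] R.V y :=
  hs ▸ (LinearMap.proj (φ := fun a : {a : Γ₁ // Λ.e a = x} => R.V (Λ.s a)) ⟨a, he⟩).comp
    (LinearMap.ker (R.sumMap x)).subtype

open Classical in
/-- The positive reflection functor `F_x⁺` at a sink `x`, on objects. An arrow that starts at
`x` after the reversal acts by `kerProj`, and every other arrow acts as it did before. -/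
def reflect (R : QuiverRep.{u, v, w} k Λ) (x : Γ₀) (hx : Λ.IsSink x) :
    QuiverRep.{u, v, w} k (Λ.reverseAt x) where
  V := R.reflectV x
  map {y z} a hs he :=
    if h : y = x then
      have h1 := hx.s_ne_of_reverseAt (hs.trans h)
      have hz : Λ.s a = z := h1.2.symm.trans he
      (R.reflectOther (fun hzx => hx a (hz.trans hzx))).symm.toLinearMap.comp
        ((R.kerProj a hz h1.1).comp (R.reflectSelf h).toLinearMap)
    else
      have h1 := hx.eq_of_reverseAt (fun h2 => h (hs.symm.trans h2))
      have hz : Λ.e a = z := h1.2.1.symm.trans he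
      (R.reflectOther (fun hzx => h1.2.2 (hz.trans hzx))).symm.toLinearMap.comp
        ((R.map a (h1.1.symm.trans hs) hz).comp (R.reflectOther h).toLinearMap)
  finite z := by
    have := R.finite
    by_cases h : z = x
    · exact Module.Finite.equiv (R.reflectSelf h).symm
    · exact Module.Finite.equiv (R.reflectOther h).symm

/-- The composition `F(S) = F_{x_s}⁺ ⋯ F_{x_1}⁺` for a `(+)`-admissible sequence
`S = x_1, …, x_s`, on objects. -/
def reflectSeq {Λ : QuiverOrientation Γ₀ Γ₁} :
    ∀ S : List Γ₀, Λ.IsAdmissible S → QuiverRep.{u, v, w} k Λ →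
      QuiverRep.{u, v, w} k (Λ.reverseSeq S)
  | [], _, R => R
  | x :: S, hS, R => reflectSeq S hS.2 (R.reflect x hS.1)

/-- The zero representation. -/
def IsZero (R : QuiverRep.{u, v, w} k Λ) : Prop := ∀ x, Subsingleton (R.V x)

/-- Some `(+)`-admissible sequence annihilates the representation. -/
def IsPreprojective (R : QuiverRep.{u, v, w} k Λ) : Prop :=
  ∃ (S : List Γ₀) (hS : Λ.IsAdmissible S), (R.reflectSeq S hS).IsZero

end

end QuiverRep

/-! ### Modules over the path algebra -/

section Modules

variable (k : Type v) [Field k] {Γ₀ : Type u} [Fintype Γ₀] {Γ₁ : Type}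
  (Λ : QuiverOrientation Γ₀ Γ₁)
  (M : Type w) [AddCommGroup M] [Module k M] [Module (PathAlgebra k Λ.Vert) M]
  [IsScalarTower k (PathAlgebra k Λ.Vert) M]

/-- The subspace `e_x M`, where `e_x` is the path of length `0` at `x`. -/
noncomputable def vertexSpace (x : Γ₀) : Submodule k M :=
  LinearMap.range (Algebra.lsmul k k M (PathAlgebra.vertex k (Λ.vert x)))

/-- The map `e_x M → e_y M` given by the action of an arrow `a : x → y`. -/
noncomputable def arrowMap {x y : Γ₀} (a : Γ₁) (hs : Λ.s a = x) (he : Λ.e a = y) :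
    vertexSpace k Λ M x →ₗ[k] vertexSpace k Λ M y :=
  ((Algebra.lsmul k k M (PathAlgebra.arrow k (Λ.hom a hs he))).comp
    (vertexSpace k Λ M x).subtype).codRestrict _ fun m =>
      ⟨PathAlgebra.arrow k (Λ.hom a hs he) • (m : M), by
        change PathAlgebra.vertex k (Λ.vert y) • PathAlgebra.arrow k (Λ.hom a hs he) • (m : M) = _
        rw [← mul_smul, PathAlgebra.vertex_mul_arrow]; rfl⟩

/-- The representation that corresponds to a finite-dimensional left module `M` over the path
algebra under the usual equivalence of categories. -/
noncomputable def moduleToRep [FiniteDimensional k M] : QuiverRep.{u, v, w} k Λ where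
  V x := ModuleCat.of k (vertexSpace k Λ M x)
  map a hs he := arrowMap k Λ M a hs he
  finite _ := inferInstanceAs (Module.Finite k (vertexSpace k Λ M _))

/-- A finite-dimensional module over the path algebra is preprojective if the corresponding
representation is annihilated by some `(+)`-admissible sequence. -/
def IsPreprojectiveModule [Fintype Γ₁] [FiniteDimensional k M] : Prop :=
  (moduleToRep k Λ M).IsPreprojective

/-- The dimension vector `(dim e_x M)_x`. -/
noncomputable def dimVector (x : Γ₀) : ℕ := Module.finrank k (vertexSpace k Λ M x)

end Modules

/-- A module is indecomposable if it is nonzero and is not the (internal) direct sum of two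
nonzero submodules. -/
def IsIndecomposableModule (A : Type*) [Ring A] (M : Type*) [AddCommGroup M] [Module A M] :
    Prop :=
  Nontrivial M ∧ ∀ P Q : Submodule A M, IsCompl P Q → P = ⊥ ∨ Q = ⊥

/-! The statement is proved for representations, by induction on the length of an admissible
sequence annihilating R = `moduleToRep k Λ M`. It is enough that this sequence kills R; nothing is
assumed about its effect on the second representation R'.

Let x be the first sink and h : ⨁ V(s a) → V(x) the sum of the arrows ending at x. A complement of
the image of h at x splits off as a direct summand, so for an indecomposable representation either h
is onto or everything sits at x (`IsIndecomposable.subsingleton_of_not_surjective`). In the second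
case all arrows of R and R' act by zero, and equal dimensions suffice. In the first case h is onto
for R' too, since otherwise R' would be one-dimensional and concentrated at x, and R, having the
same dimensions, could not have h onto.

When h is onto, reflection loses nothing: V(x) is the quotient of ⨁ V(s a) by Ker h. Hence
indecomposability passes to the reflection (`IsIndecomposable.reflect`), its dimensions depend only
on the old ones (`finrank_reflect_self`), and isomorphisms of reflections lift back
(`nonempty_equiv_of_reflect`). The empty sequence cannot kill an indecomposable representation,
which starts the induction. -/

namespace QuiverOrientation

variable {Γ₀ : Type*} {Γ₁ : Type} {Λ : QuiverOrientation Γ₀ Γ₁} {x : Γ₀} {a : Γ₁}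

theorem IsSink.ne (hx : Λ.IsSink x) (a : Γ₁) : Λ.s a ≠ x := hx a

theorem reverseAt_of_e_eq (he : Λ.e a = x) :
    (Λ.reverseAt x).s a = x ∧ (Λ.reverseAt x).e a = Λ.s a := by
  simp [reverseAt, he]

theorem reverseAt_of_ne (hs : Λ.s a ≠ x) (he : Λ.e a ≠ x) :
    (Λ.reverseAt x).s a = Λ.s a ∧ (Λ.reverseAt x).e a = Λ.e a := by
  simp [reverseAt, he, hs]

end QuiverOrientation

/-! ### Subrepresentations and isomorphisms in the presence of a sink -/

namespace QuiverRep

variable {k : Type*} [Field k] {Γ₀ : Type*} {Γ₁ : Type} {Λ : QuiverOrientation Γ₀ Γ₁}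

/-- A family of subspaces that is a subrepresentation. -/
def IsStable (R : QuiverRep k Λ) (P : ∀ z, Submodule k (R.V z)) : Prop :=
  ∀ (y z : Γ₀) (a : Γ₁) (hs : Λ.s a = y) (he : Λ.e a = z), ∀ v ∈ P y, R.map a hs he v ∈ P z

/-- A representation is indecomposable if it is nonzero and is not the direct sum of two nonzero
subrepresentations. -/
def IsIndecomposable (R : QuiverRep k Λ) : Prop :=
  ¬ R.IsZero ∧ ∀ P Q : ∀ z, Submodule k (R.V z), R.IsStable P → R.IsStable Q →
    (∀ z, IsCompl (P z) (Q z)) → (∀ z, P z = ⊥) ∨ ∀ z, Q z = ⊥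

/-- An isomorphism of representations. -/
structure Equiv (R R' : QuiverRep k Λ) where
  /-- The linear equivalence at a vertex. -/
  equiv : ∀ z, R.V z ≃ₗ[k] R'.V z
  comm : ∀ (y z : Γ₀) (a : Γ₁) (hs : Λ.s a = y) (he : Λ.e a = z) (v : R.V y),
    equiv z (R.map a hs he v) = R'.map a hs he (equiv y v)

variable {x : Γ₀}

open Classical in
/-- The family of subspaces with given values at `x` and outside `x`. -/
noncomputable def subspaceAt (R : QuiverRep k Λ) (x : Γ₀) (U : Submodule k (R.V x))
    (P : ∀ z, z ≠ x → Submodule k (R.V z)) (z : Γ₀) : Submodule k (R.V z) :=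
  if h : z = x then h ▸ U else P z h

theorem subspaceAt_self (R : QuiverRep k Λ) (U : Submodule k (R.V x))
    (P : ∀ z, z ≠ x → Submodule k (R.V z)) : R.subspaceAt x U P x = U := by
  simp [subspaceAt]

theorem subspaceAt_of_ne (R : QuiverRep k Λ) (U : Submodule k (R.V x))
    (P : ∀ z, z ≠ x → Submodule k (R.V z)) {z : Γ₀} (h : z ≠ x) :
    R.subspaceAt x U P z = P z h := by
  simp [subspaceAt, h]

theorem isCompl_subspaceAt (R : QuiverRep k Λ) {U U' : Submodule k (R.V x)}
    {P P' : ∀ z, z ≠ x → Submodule k (R.V z)} (hU : IsCompl U U')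
    (hP : ∀ z h, IsCompl (P z h) (P' z h)) (z : Γ₀) :
    IsCompl (R.subspaceAt x U P z) (R.subspaceAt x U' P' z) := by
  by_cases h : z = x
  · subst h
    simpa only [subspaceAt_self] using hU
  · simpa only [subspaceAt_of_ne _ _ _ h] using hP z h

/-- No arrow starts at the sink, so each arrow either ends at x or avoids it; U only has to absorb
the incoming images. -/
theorem isStable_subspaceAt (R : QuiverRep k Λ) (hx : Λ.IsSink x) {U : Submodule k (R.V x)}
    {P : ∀ z, z ≠ x → Submodule k (R.V z)}
    (h₁ : ∀ (a : Γ₁) (he : Λ.e a = x), ∀ v ∈ P (Λ.s a) (hx.ne a), R.map a rfl he v ∈ U)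
    (h₂ : ∀ (a : Γ₁) (he : Λ.e a ≠ x), ∀ v ∈ P (Λ.s a) (hx.ne a),
      R.map a rfl rfl v ∈ P (Λ.e a) he) :
    R.IsStable (R.subspaceAt x U P) := by
  rintro y z a rfl he v hv
  rw [subspaceAt_of_ne _ _ _ (hx.ne a)] at hv
  by_cases h : z = x
  · subst h
    rw [subspaceAt_self]
    exact h₁ a he v hv
  · subst he
    rw [subspaceAt_of_ne _ _ _ h]
    exact h₂ a h v hv

open Classical in
/-- The family of linear equivalences with given values at `x` and outside `x`. -/
noncomputable def equivAt {R R' : QuiverRep k Λ} (x : Γ₀) (f : R.V x ≃ₗ[k] R'.V x)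
    (g : ∀ z, z ≠ x → R.V z ≃ₗ[k] R'.V z) (z : Γ₀) : R.V z ≃ₗ[k] R'.V z :=
  if h : z = x then h ▸ f else g z h

/-- With no arrow leaving x, these two kinds of squares are all that must commute. -/
theorem nonempty_equiv_of_sink {R R' : QuiverRep k Λ} (hx : Λ.IsSink x)
    (f : R.V x ≃ₗ[k] R'.V x) (g : ∀ z, z ≠ x → R.V z ≃ₗ[k] R'.V z)
    (h₁ : ∀ (a : Γ₁) (he : Λ.e a = x) v,
      f (R.map a rfl he v) = R'.map a rfl he (g (Λ.s a) (hx.ne a) v))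
    (h₂ : ∀ (a : Γ₁) (he : Λ.e a ≠ x) v,
      g (Λ.e a) he (R.map a rfl rfl v) = R'.map a rfl rfl (g (Λ.s a) (hx.ne a) v)) :
    Nonempty (R.Equiv R') := by
  refine ⟨⟨equivAt x f g, ?_⟩⟩
  rintro y z a rfl he v
  have hg {z} (hz : z ≠ x) : equivAt x f g z = g z hz := by simp [equivAt, hz]
  rw [hg (hx.ne a)]
  by_cases h : z = x
  · subst h
    have : equivAt z f g z = f := by simp [equivAt]
    rw [this]
    exact h₁ a he v
  · subst he
    rw [hg h]
    exact h₂ a h v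

theorem subsingleton_of_finrank_eq {R R' : QuiverRep k Λ} {z : Γ₀}
    (hdim : Module.finrank k (R.V z) = Module.finrank k (R'.V z)) (h : Subsingleton (R.V z)) :
    Subsingleton (R'.V z) := by
  have := R'.finite z
  rw [Module.finrank_zero_of_subsingleton] at hdim
  exact Module.finrank_zero_iff.1 hdim.symm

/-- An indecomposable representation concentrated at a sink `x` has dimension `1` there. -/
theorem IsIndecomposable.finrank_eq_one {R : QuiverRep k Λ}
    (hR : R.IsIndecomposable) (hx : Λ.IsSink x)
    (h : ∀ z ≠ x, Subsingleton (R.V z)) : Module.finrank k (R.V x) = 1 := by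
  have hnz : ¬ Subsingleton (R.V x) := fun h' => hR.1 fun z => by
    by_cases hz : z = x
    · exact hz ▸ h'
    · exact h z hz
  obtain ⟨v, hv⟩ := @exists_ne _ (not_subsingleton_iff_nontrivial.1 hnz) (0 : R.V x)
  obtain ⟨Q, hQ⟩ := Submodule.exists_isCompl (k ∙ v)
  -- Any subspace at a sink is a subrepresentation, so a complement of the line through v must
  -- vanish.
  have hst (U : Submodule k (R.V x)) : R.IsStable (R.subspaceAt x U fun _ _ => ⊥) :=
    R.isStable_subspaceAt hx
      (fun a he v hv => by rw [(Submodule.mem_bot k).1 hv, map_zero]; exact zero_mem _)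
      (fun a he v hv => by rw [(Submodule.mem_bot k).1 hv, map_zero]; exact zero_mem _)
  rcases hR.2 _ _ (hst (k ∙ v)) (hst Q) (R.isCompl_subspaceAt hQ fun z hz => by
      have := h z hz
      constructor
      · exact disjoint_bot_left
      · rw [codisjoint_iff]; exact Subsingleton.elim _ _) with h' | h'
  · have := h' x
    rw [subspaceAt_self, Submodule.span_singleton_eq_bot] at this
    exact absurd this hv
  · have := h' x
    rw [subspaceAt_self] at this
    subst this
    have htop : (k ∙ v) = ⊤ := by simpa using hQ.sup_eq_top
    rw [← finrank_top, ← htop, finrank_span_singleton hv]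

/-! ### Reflection at a sink -/

variable [Fintype Γ₁]

theorem sumMap_single [DecidableEq Γ₁] (R : QuiverRep k Λ)
    (a : {a : Γ₁ // Λ.e a = x}) (v : R.V (Λ.s a)) :
    R.sumMap x (Pi.single a v) = R.map a.1 rfl a.2 v := by
  classical
  rw [sumMap, LinearMap.sum_apply, Finset.sum_eq_single a]
  · simp
  · intro b _ hb
    simp [Pi.single_eq_of_ne hb]
  · simp

/-- The space at `x` of the reflection at `x`. -/
noncomputable def reflectEquivSelf (R : QuiverRep k Λ) (hx : Λ.IsSink x) :
    (R.reflect x hx).V x ≃ₗ[k] LinearMap.ker (R.sumMap x) :=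
  R.reflectSelf rfl

/-- The space at `z ≠ x` of the reflection at `x`. -/
noncomputable def reflectEquivOther (R : QuiverRep k Λ) (hx : Λ.IsSink x) {z : Γ₀}
    (hz : z ≠ x) : (R.reflect x hx).V z ≃ₗ[k] R.V z :=
  R.reflectOther hz

theorem reflect_map_self (R : QuiverRep k Λ) {x : Γ₀} (hx : Λ.IsSink x) (a : Γ₁)
    (he : Λ.e a = x) (hs' : (Λ.reverseAt x).s a = x) (he' : (Λ.reverseAt x).e a = Λ.s a)
    (w : (R.reflect x hx).V x) :
    R.reflectEquivOther hx (hx.ne a) ((R.reflect x hx).map a hs' he' w) =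
      (R.reflectEquivSelf hx w).1 ⟨a, he⟩ := by
  simp only [reflect, dif_pos]
  exact LinearEquiv.apply_symm_apply _ _

theorem reflect_map_other (R : QuiverRep k Λ) {x : Γ₀} (hx : Λ.IsSink x) {y z : Γ₀} (a : Γ₁)
    (hy : y ≠ x) (hz : z ≠ x) (hs : Λ.s a = y) (he : Λ.e a = z)
    (hs' : (Λ.reverseAt x).s a = y) (he' : (Λ.reverseAt x).e a = z)
    (w : (R.reflect x hx).V y) :
    R.reflectEquivOther hx hz ((R.reflect x hx).map a hs' he' w) =
      R.map a hs he (R.reflectEquivOther hx hy w) := by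
  simp only [reflect, dif_neg hy]
  exact LinearEquiv.apply_symm_apply _ _

/-- An indecomposable representation for which `sumMap` at a sink `x` is not surjective is
concentrated at `x`. -/
theorem IsIndecomposable.subsingleton_of_not_surjective {R : QuiverRep k Λ}
    (hR : R.IsIndecomposable) (hx : Λ.IsSink x) (h : ¬ Function.Surjective (R.sumMap x))
    {z : Γ₀} (hz : z ≠ x) : Subsingleton (R.V z) := by
  classical
  obtain ⟨Q, hQ⟩ := Submodule.exists_isCompl (LinearMap.range (R.sumMap x))
  -- Split R into the image of h together with everything outside x, and a complement Q of that
  -- image placed at x alone.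
  rcases hR.2 (R.subspaceAt x (LinearMap.range (R.sumMap x)) fun _ _ => ⊤)
    (R.subspaceAt x Q fun _ _ => ⊥)
    (R.isStable_subspaceAt hx
      (fun a he v _ => ⟨Pi.single ⟨a, he⟩ v, R.sumMap_single ⟨a, he⟩ v⟩)
      (fun _ _ _ _ => trivial))
    (R.isStable_subspaceAt hx
      (fun a he v hv => by rw [(Submodule.mem_bot k).1 hv, map_zero]; exact zero_mem _)
      (fun a he v hv => by rw [(Submodule.mem_bot k).1 hv, map_zero]; exact zero_mem _))
    (R.isCompl_subspaceAt hQ fun _ _ => isCompl_top_bot) with h' | h'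
  · have := h' z
    rw [subspaceAt_of_ne _ _ _ hz] at this
    exact (Submodule.subsingleton_iff k).1 (subsingleton_of_bot_eq_top this.symm)
  · have := h' x
    rw [subspaceAt_self] at this
    subst this
    exact absurd (LinearMap.range_eq_top.1 (by simpa using hQ.sup_eq_top)) h

/-- The reflection at a sink `x` of an indecomposable representation with surjective `sumMap` at
`x` is indecomposable. -/
theorem IsIndecomposable.reflect {R : QuiverRep k Λ} (hR : R.IsIndecomposable)
    (hx : Λ.IsSink x) (hsurj : Function.Surjective (R.sumMap x)) :
    (R.reflect x hx).IsIndecomposable := by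
  classical
  have hW {z : Γ₀} (hz : z ≠ x) (h : Subsingleton ((R.reflect x hx).V z)) :
      Subsingleton (R.V z) := (R.reflectEquivOther hx hz).symm.toEquiv.subsingleton
  refine ⟨fun h0 => hR.1 fun z => ?_, fun P Q hP hQ hPQ => ?_⟩
  · by_cases hz : z = x
    · subst hz
      have (a : {a : Γ₁ // Λ.e a = z}) : Subsingleton (R.V (Λ.s a)) := hW (hx.ne a) (h0 _)
      exact hsurj.subsingleton
    · exact hW hz (h0 z)
  -- A decomposition of the reflection is carried back to R: `T P` transports P outside x, and `U P`
  -- is what the incoming arrows generate from it at x.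
  · let T (P : ∀ z, Submodule k ((R.reflect x hx).V z)) (z : Γ₀) (hz : z ≠ x) :
        Submodule k (R.V z) := (P z).map (R.reflectEquivOther hx hz).toLinearMap
    let U (P : ∀ z, Submodule k ((R.reflect x hx).V z)) : Submodule k (R.V x) :=
      (Submodule.pi Set.univ fun a : {a : Γ₁ // Λ.e a = x} => T P (Λ.s a) (hx.ne a)).map (R.sumMap x)
    have hT (z) (hz : z ≠ x) : IsCompl (T P z hz) (T Q z hz) :=
      (Submodule.orderIsoMapComap (R.reflectEquivOther hx hz)).isCompl (hPQ z)
    have hst (P) (hP : (R.reflect x hx).IsStable P) : R.IsStable (R.subspaceAt x (U P) (T P)) := by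
      refine R.isStable_subspaceAt hx (fun a he v hv => ?_) (fun a he v hv => ?_)
      · refine ⟨Pi.single ⟨a, he⟩ v, fun b _ => ?_, R.sumMap_single ⟨a, he⟩ v⟩
        by_cases hb : b = ⟨a, he⟩
        · subst hb
          simpa using hv
        · rw [Pi.single_eq_of_ne hb]
          exact zero_mem _
      · obtain ⟨w, hw, rfl⟩ := hv
        have h' := QuiverOrientation.reverseAt_of_ne (hx.ne a) he
        exact ⟨_, hP _ _ a h'.1 h'.2 w hw, R.reflect_map_other hx a _ _ _ _ _ _ w⟩
    -- The reversed arrows act as the coordinate projections of Ker h, so stability puts the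
    -- coordinates of an element of P x into `T P`.
    have hcomp (P) (hP : (R.reflect x hx).IsStable P) (w) (hw : w ∈ P x)
        (a : {a : Γ₁ // Λ.e a = x}) :
        (R.reflectEquivSelf hx w).1 a ∈ T P (Λ.s a) (hx.ne a) := by
      have h' := QuiverOrientation.reverseAt_of_e_eq a.2
      exact ⟨_, hP _ _ a.1 h'.1 h'.2 w hw, R.reflect_map_self hx a.1 a.2 h'.1 h'.2 w⟩
    have hU : IsCompl (U P) (U Q) := by
      constructor
      · rw [Submodule.disjoint_def]
        rintro _ ⟨p, hp, rfl⟩ ⟨q, hq, hpq⟩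
        -- If h p = h q, write p - q = p₀ + q₀ in Ker h along P x and Q x. Each coordinate of p - p₀
        -- = q + q₀ lies in both `T P` and `T Q`, so p = p₀ lies in Ker h and the common value is 0.
        have hker : p - q ∈ LinearMap.ker (R.sumMap x) := by
          rw [LinearMap.mem_ker, map_sub, hpq, sub_self]
        obtain ⟨w, hw⟩ := (R.reflectEquivSelf hx).surjective ⟨p - q, hker⟩
        obtain ⟨p₀, hp₀, q₀, hq₀, rfl⟩ := Submodule.mem_sup.1
          ((hPQ x).sup_eq_top ▸ Submodule.mem_top : w ∈ P x ⊔ Q x)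
        have key : p = (R.reflectEquivSelf hx p₀).1 := by
          funext a
          have e := congrFun (congrArg Subtype.val hw) a
          have e' : (R.reflectEquivSelf hx p₀).1 a + (R.reflectEquivSelf hx q₀).1 a = p a - q a := by
            rw [map_add] at e
            exact e
          have h1 := Submodule.sub_mem _ (hp a trivial) (hcomp P hP p₀ hp₀ a)
          have h2 := Submodule.add_mem _ (hq a trivial) (hcomp Q hQ q₀ hq₀ a)
          have h3 : p a - (R.reflectEquivSelf hx p₀).1 a = q a + (R.reflectEquivSelf hx q₀).1 a := by
            rw [sub_eq_iff_eq_add, add_assoc, add_comm _ ((R.reflectEquivSelf hx p₀).1 a), e']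
            abel
          exact sub_eq_zero.1 ((Submodule.disjoint_def.1 (hT _ (hx.ne a)).disjoint) _ h1 (h3 ▸ h2))
        rw [key]
        exact (R.reflectEquivSelf hx p₀).2
      · rw [codisjoint_iff, eq_top_iff]
        rintro v -
        -- Surjectivity of h lets v be split by splitting the coordinates of a preimage.
        obtain ⟨u, rfl⟩ := hsurj v
        have (a : {a : Γ₁ // Λ.e a = x}) :
            ∃ p ∈ T P (Λ.s a) (hx.ne a), ∃ q ∈ T Q (Λ.s a) (hx.ne a), p + q = u a :=
          Submodule.mem_sup.1 ((hT _ (hx.ne a)).sup_eq_top ▸ Submodule.mem_top)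
        choose p hp q hq hpq using this
        refine Submodule.mem_sup.2 ⟨_, ⟨p, fun a _ => hp a, rfl⟩, _, ⟨q, fun a _ => hq a, rfl⟩, ?_⟩
        rw [← map_add]
        congr 1
        exact funext hpq
    have hzero (P) (hP : (R.reflect x hx).IsStable P)
        (h : ∀ z, R.subspaceAt x (U P) (T P) z = ⊥) (z) : P z = ⊥ := by
      have hTz (z) (hz : z ≠ x) : T P z hz = ⊥ := by
        rw [← R.subspaceAt_of_ne (U P) (T P) hz, h]
      by_cases hz : z = x
      · subst hz
        refine (Submodule.eq_bot_iff _).2 fun w hw => ?_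
        -- An element of Ker h is determined by its coordinates, here all in `T P`, which is zero.
        rw [← (R.reflectEquivSelf hx).map_eq_zero_iff]
        ext a
        have := hcomp P hP w hw a
        rw [hTz] at this
        exact (Submodule.mem_bot k).1 this
      · exact (Submodule.map_eq_bot_iff (e := R.reflectEquivOther hx hz) (p := P z)).1 (hTz z hz)
    exact (hR.2 _ _ (hst P hP) (hst Q hQ) (R.isCompl_subspaceAt hU hT)).imp
      (hzero P hP) (hzero Q hQ)

theorem finrank_reflect_other (R : QuiverRep k Λ) (hx : Λ.IsSink x) {z : Γ₀} (hz : z ≠ x) :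
    Module.finrank k ((R.reflect x hx).V z) = Module.finrank k (R.V z) :=
  (R.reflectEquivOther hx hz).finrank_eq

/-- Rank-nullity for h. Using `∑ᶠ` keeps a choice of `Fintype` instance on the subtype out of the
statement. -/
theorem finrank_reflect_self (R : QuiverRep k Λ) (hx : Λ.IsSink x)
    (hsurj : Function.Surjective (R.sumMap x)) :
    Module.finrank k (R.V x) + Module.finrank k ((R.reflect x hx).V x) =
      ∑ᶠ a : {a : Γ₁ // Λ.e a = x}, Module.finrank k (R.V (Λ.s a)) := by
  classical
  have := R.finite
  rw [finsum_eq_sum_of_fintype, (R.reflectEquivSelf hx).finrank_eq, ← Module.finrank_pi_fintype k,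
    ← (R.sumMap x).finrank_range_add_finrank_ker, LinearMap.range_eq_top.2 hsurj, finrank_top]

/-- Representations whose `sumMap`s at a sink are surjective are determined by their
reflections. -/
theorem nonempty_equiv_of_reflect {R R' : QuiverRep k Λ} (hx : Λ.IsSink x)
    (hR : Function.Surjective (R.sumMap x)) (hR' : Function.Surjective (R'.sumMap x))
    (ψ : (R.reflect x hx).Equiv (R'.reflect x hx)) : Nonempty (R.Equiv R') := by
  classical
  let g (z : Γ₀) (hz : z ≠ x) : R.V z ≃ₗ[k] R'.V z :=
    (R.reflectEquivOther hx hz).symm ≪≫ₗ ψ.equiv z ≪≫ₗ R'.reflectEquivOther hx hz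
  have hg (z) (hz : z ≠ x) (w) : g z hz (R.reflectEquivOther hx hz w) =
      R'.reflectEquivOther hx hz (ψ.equiv z w) := by simp [g]
  let E := LinearEquiv.piCongrRight fun a : {a : Γ₁ // Λ.e a = x} => g (Λ.s a) (hx.ne a)
  have hE (w : (R.reflect x hx).V x) :
      E (R.reflectEquivSelf hx w).1 = (R'.reflectEquivSelf hx (ψ.equiv x w)).1 := by
    funext a
    have h' := QuiverOrientation.reverseAt_of_e_eq a.2
    have e₁ := R.reflect_map_self hx a.1 a.2 h'.1 h'.2 w
    have e₂ := R'.reflect_map_self hx a.1 a.2 h'.1 h'.2 (ψ.equiv x w)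
    rw [← ψ.comm, ← hg, e₁] at e₂
    exact e₂
  -- The isomorphism ψ at x is the restriction of E to the kernels, by compatibility with the
  -- coordinate projections; so E descends to the quotients, which are the spaces at x.
  have hker : (LinearMap.ker (R.sumMap x)).map E.toLinearMap = LinearMap.ker (R'.sumMap x) := by
    apply le_antisymm
    · rintro _ ⟨u, hu, rfl⟩
      obtain ⟨w, hw⟩ := (R.reflectEquivSelf hx).surjective ⟨u, hu⟩
      have := hE w
      rw [hw] at this
      exact this ▸ (R'.reflectEquivSelf hx (ψ.equiv x w)).2
    · intro u hu
      obtain ⟨w, hw⟩ := (R'.reflectEquivSelf hx).surjective ⟨u, hu⟩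
      have := hE ((ψ.equiv x).symm w)
      rw [LinearEquiv.apply_symm_apply, hw] at this
      exact ⟨_, (R.reflectEquivSelf hx ((ψ.equiv x).symm w)).2, this⟩
  let f : R.V x ≃ₗ[k] R'.V x := ((R.sumMap x).quotKerEquivOfSurjective hR).symm ≪≫ₗ
    Submodule.Quotient.equiv _ _ E hker ≪≫ₗ (R'.sumMap x).quotKerEquivOfSurjective hR'
  have hf (u) : f (R.sumMap x u) = R'.sumMap x (E u) := by
    have : ((R.sumMap x).quotKerEquivOfSurjective hR).symm (R.sumMap x u) =
        Submodule.Quotient.mk u := by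
      rw [LinearEquiv.symm_apply_eq]
      rfl
    simp only [f, LinearEquiv.trans_apply, this]
    rfl
  refine nonempty_equiv_of_sink hx f g (fun a he v => ?_) (fun a he v => ?_)
  -- An arrow into x is h composed with the inclusion of its summand.
  · rw [← R.sumMap_single ⟨a, he⟩, hf, ← R'.sumMap_single ⟨a, he⟩]
    congr 1
    funext b
    change g (Λ.s b) (hx.ne b) (Pi.single (M := fun a : {a : Γ₁ // Λ.e a = x} => R.V (Λ.s a))
      ⟨a, he⟩ v b) = _
    by_cases hb : b = ⟨a, he⟩
    · subst hb
      simp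
    · rw [Pi.single_eq_of_ne hb, Pi.single_eq_of_ne hb, map_zero]
  · have h' := QuiverOrientation.reverseAt_of_ne (hx.ne a) he
    obtain ⟨w, rfl⟩ := (R.reflectEquivOther hx (hx.ne a)).surjective v
    rw [← R.reflect_map_other hx a (hx.ne a) he rfl rfl h'.1 h'.2, hg, hg, ψ.comm,
      R'.reflect_map_other hx a (hx.ne a) he rfl rfl h'.1 h'.2]

/-! ### Induction along an admissible sequence -/

theorem not_surjective_sumMap {R : QuiverRep k Λ} (hx : Λ.IsSink x)
    (h : ∀ z ≠ x, Subsingleton (R.V z)) (h1 : Module.finrank k (R.V x) = 1) :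
    ¬ Function.Surjective (R.sumMap x) := fun hs => by
  -- A sink carries no loop, so the source of h is zero.
  have (a : {a : Γ₁ // Λ.e a = x}) : Subsingleton (R.V (Λ.s a)) := h _ (hx.ne a)
  have := hs.subsingleton
  rw [Module.finrank_zero_of_subsingleton] at h1
  exact zero_ne_one h1

/-- An indecomposable representation annihilated by an admissible sequence is determined up to
isomorphism among the indecomposable representations by its dimension vector. -/
theorem nonempty_equiv_of_isZero_reflectSeq (S : List Γ₀) :
    ∀ {Λ : QuiverOrientation Γ₀ Γ₁} (hS : Λ.IsAdmissible S) (R R' : QuiverRep k Λ),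
      R.IsIndecomposable → R'.IsIndecomposable →
      (∀ z, Module.finrank k (R.V z) = Module.finrank k (R'.V z)) →
      (R.reflectSeq S hS).IsZero → Nonempty (R.Equiv R') := by
  induction S with
  | nil => exact fun _ _ _ hR _ _ h0 => absurd h0 hR.1
  | cons x S ih =>
    intro Λ hS R R' hR hR' hdim h0
    have hx := hS.1
    by_cases hs : Function.Surjective (R.sumMap x)
    · have hs' : Function.Surjective (R'.sumMap x) := by
        by_contra hs'
        have hz' (z) (hz : z ≠ x) := hR'.subsingleton_of_not_surjective hx hs' hz
        exact not_surjective_sumMap hx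
          (fun z hz => subsingleton_of_finrank_eq (hdim z).symm (hz' z hz))
          ((hdim x).trans (hR'.finrank_eq_one hx hz')) hs
      obtain ⟨ψ⟩ := ih hS.2 (R.reflect x hx) (R'.reflect x hx) (hR.reflect hx hs)
        (hR'.reflect hx hs') (fun z => by
          by_cases hz : z = x
          · subst hz
            have e := R.finrank_reflect_self hx hs
            have e' := R'.finrank_reflect_self hx hs'
            -- Both sums over incoming arrows now agree, so the dimensions of the two kernels do.
            simp only [hdim] at e
            omega
          · rw [finrank_reflect_other _ hx hz, finrank_reflect_other _ hx hz, hdim]) h0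
      exact nonempty_equiv_of_reflect hx hs hs' ψ
    · have hz (z) (hz : z ≠ x) := hR.subsingleton_of_not_surjective hx hs hz
      have hz' (z) (hzx : z ≠ x) := subsingleton_of_finrank_eq (hdim z) (hz z hzx)
      have := R.finite
      have := R'.finite
      -- Both representations vanish outside x, so every square commutes trivially and arbitrary
      -- linear isomorphisms work.
      refine nonempty_equiv_of_sink hx (LinearEquiv.ofFinrankEq _ _ (hdim x))
        (fun z _ => LinearEquiv.ofFinrankEq _ _ (hdim z)) (fun a he v => ?_) (fun a he v => ?_)
      · have := hz _ (hx.ne a)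
        rw [Subsingleton.elim v 0]
        simp
      · have := hz' _ he
        exact Subsingleton.elim _ _

end QuiverRep

/-! ### From modules over the path algebra to representations and back -/

section Modules

open PathAlgebra

variable {k : Type*} [Field k] {Γ₀ : Type*} [Fintype Γ₀] {Γ₁ : Type}
  {Λ : QuiverOrientation Γ₀ Γ₁}
  {M : Type*} [AddCommGroup M] [Module k M] [Module (PathAlgebra k Λ.Vert) M]
  [IsScalarTower k (PathAlgebra k Λ.Vert) M]
  {N : Type*} [AddCommGroup N] [Module k N] [Module (PathAlgebra k Λ.Vert) N]
  [IsScalarTower k (PathAlgebra k Λ.Vert) N]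

/-- The projection `m ↦ e_x m` of `M` onto `e_x M`. -/
noncomputable def vertexProj (Λ : QuiverOrientation Γ₀ Γ₁) (M : Type*) [AddCommGroup M]
    [Module k M] [Module (PathAlgebra k Λ.Vert) M] [IsScalarTower k (PathAlgebra k Λ.Vert) M]
    (x : Γ₀) : M →ₗ[k] vertexSpace k Λ M x :=
  (Algebra.lsmul k k M (PathAlgebra.vertex k (Λ.vert x))).rangeRestrict

theorem coe_vertexProj (x : Γ₀) (m : M) :
    (vertexProj (k := k) Λ M x m : M) = PathAlgebra.vertex k (Λ.vert x) • m := rfl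

theorem sum_vertexProj (m : M) : ∑ x, (vertexProj (k := k) Λ M x m : M) = m := by
  simp only [coe_vertexProj]
  rw [← Finset.sum_smul]
  exact one_smul (PathAlgebra k Λ.Vert) m

theorem vertexProj_coe_self {x : Γ₀} (v : vertexSpace k Λ M x) :
    vertexProj (k := k) Λ M x (v : M) = v := by
  obtain ⟨_, m, rfl⟩ := v
  apply Subtype.ext
  rw [coe_vertexProj]
  change _ • vertex k (Λ.vert x) • m = vertex k (Λ.vert x) • m
  rw [← mul_smul, vertex, ofPath_mul_ofPath, mulPath_comp]
  rfl

theorem vertexProj_coe_of_ne {x y : Γ₀} (h : x ≠ y) (v : vertexSpace k Λ M x) :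
    vertexProj (k := k) Λ M y (v : M) = 0 := by
  obtain ⟨_, m, rfl⟩ := v
  apply Subtype.ext
  rw [coe_vertexProj]
  change _ • vertex k (Λ.vert x) • m = 0
  rw [← mul_smul, vertex, vertex, ofPath_mul_ofPath, mulPath_ne (by exact h), zero_smul]

/-- Both sides come from e_y a = a = a e_x. -/
theorem vertexProj_arrow_smul {x y : Γ₀} (a : Γ₁) (hs : Λ.s a = x) (he : Λ.e a = y) (m : M) :
    vertexProj (k := k) Λ M y (arrow k (Λ.hom a hs he) • m) =
      arrowMap k Λ M a hs he (vertexProj Λ M x m) := by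
  apply Subtype.ext
  rw [coe_vertexProj, ← mul_smul, vertex_mul_arrow]
  change _ = arrow k (Λ.hom a hs he) • vertex k (Λ.vert x) • m
  rw [← mul_smul, arrow, vertex, ofPath_mul_ofPath, mulPath_comp, Quiver.Path.nil_comp]

theorem vertexProj_arrow_smul_of_ne {x y z : Γ₀} (a : Γ₁) (hs : Λ.s a = x) (he : Λ.e a = y)
    (h : y ≠ z) (m : M) :
    vertexProj (k := k) Λ M z (arrow k (Λ.hom a hs he) • m) = 0 := by
  apply Subtype.ext
  rw [coe_vertexProj, ← mul_smul, arrow, vertex, ofPath_mul_ofPath, mulPath_ne (by exact h),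
    zero_smul]
  rfl

/-- The path algebra is generated by the vertices and the arrows. -/
theorem PathAlgebra.generator_induction {P : PathAlgebra k Λ.Vert → Prop} (h0 : P 0)
    (hadd : ∀ a b, P a → P b → P (a + b)) (hsmul : ∀ (c : k) a, P a → P (c • a))
    (hmul : ∀ a b, P a → P b → P (a * b)) (hv : ∀ x : Γ₀, P (vertex k (Λ.vert x)))
    (ha : ∀ (x y : Γ₀) (a : Γ₁) (hs : Λ.s a = x) (he : Λ.e a = y), P (arrow k (Λ.hom a hs he)))
    (a : PathAlgebra k Λ.Vert) : P a := by
  induction a using PathAlgebra.induction_on with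
  | h0 => exact h0
  | hadd a b h h' => exact hadd a b h h'
  | hp c p =>
    apply hsmul
    obtain ⟨x, y, p⟩ := p
    induction p with
    | nil => exact hv x
    | cons p e ih =>
      obtain ⟨a, hs, he⟩ := e
      -- Products run right to left, so the last arrow of the path is the left factor.
      have := hmul _ _ (ha _ _ a hs he) ih
      rw [arrow, ofPath_mul_ofPath] at this
      erw [mulPath_comp] at this
      exact this

/-- The submodule given by a subrepresentation. -/
noncomputable def submoduleOfStable [FiniteDimensional k M]
    (P : ∀ z, Submodule k ((moduleToRep k Λ M).V z)) (hP : (moduleToRep k Λ M).IsStable P) :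
    Submodule (PathAlgebra k Λ.Vert) M where
  carrier := {m | ∀ z, vertexProj Λ M z m ∈ P z}
  zero_mem' z := by rw [map_zero]; exact zero_mem _
  add_mem' hm hm' z := by rw [map_add]; exact add_mem (hm z) (hm' z)
  smul_mem' a := by
    -- The element m stays quantified, so that the product case can compose the two hypotheses.
    induction a using PathAlgebra.generator_induction with
    | h0 => intro m _ z; rw [zero_smul, map_zero]; exact zero_mem _
    | hadd a b h h' => intro m hm z; rw [add_smul, map_add]; exact add_mem (h hm z) (h' hm z)
    | hsmul c a h => intro m hm z; rw [smul_assoc, map_smul]; exact Submodule.smul_mem _ _ (h hm z)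
    | hmul a b h h' => intro m hm; rw [mul_smul]; exact h (h' hm)
    | hv x =>
      intro m hm z
      rw [← coe_vertexProj]
      by_cases h : x = z
      · subst h
        rw [vertexProj_coe_self]
        exact hm x
      · rw [vertexProj_coe_of_ne h]
        exact zero_mem _
    | ha x y a hs he =>
      intro m hm z
      by_cases h : y = z
      · subst h
        rw [vertexProj_arrow_smul]
        exact hP _ _ a hs he _ (hm x)
      · rw [vertexProj_arrow_smul_of_ne _ _ _ h]
        exact zero_mem _

theorem coe_mem_submoduleOfStable [FiniteDimensional k M]
    {P : ∀ z, Submodule k ((moduleToRep k Λ M).V z)} {hP : (moduleToRep k Λ M).IsStable P}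
    {z : Γ₀} {v : vertexSpace k Λ M z} (hv : v ∈ P z) : (v : M) ∈ submoduleOfStable P hP := by
  intro y
  by_cases h : z = y
  · subst h
    rwa [vertexProj_coe_self]
  · rw [vertexProj_coe_of_ne h]
    exact zero_mem _

/-- Since m is the sum of its components e_z m, complementary subrepresentations give complementary
submodules. -/
theorem IsIndecomposableModule.moduleToRep [FiniteDimensional k M]
    (hM : IsIndecomposableModule (PathAlgebra k Λ.Vert) M) :
    (moduleToRep k Λ M).IsIndecomposable := by
  refine ⟨fun h0 => ?_, fun P Q hP hQ hPQ => ?_⟩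
  · have := hM.1
    obtain ⟨m, hm⟩ := exists_ne (0 : M)
    apply hm
    rw [← sum_vertexProj (k := k) (Λ := Λ) m]
    refine Finset.sum_eq_zero fun x _ => ?_
    have : Subsingleton (vertexSpace k Λ M x) := h0 x
    rw [Subsingleton.elim (vertexProj Λ M x m) 0]
    rfl
  · have hzero {P} {hP : (_root_.moduleToRep k Λ M).IsStable P} (h : submoduleOfStable P hP = ⊥)
        (z) : P z = ⊥ := by
      refine (Submodule.eq_bot_iff _).2 fun v hv => ?_
      have := coe_mem_submoduleOfStable (hP := hP) hv
      rw [h, Submodule.mem_bot] at this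
      exact Subtype.ext this
    refine (hM.2 (submoduleOfStable P hP) (submoduleOfStable Q hQ) ⟨?_, ?_⟩).imp hzero hzero
    · rw [Submodule.disjoint_def]
      intro m hm hm'
      rw [← sum_vertexProj (k := k) (Λ := Λ) m]
      refine Finset.sum_eq_zero fun z _ => ?_
      have := Submodule.disjoint_def.1 (hPQ z).disjoint _ (hm z) (hm' z)
      exact congrArg Subtype.val this
    · rw [codisjoint_iff, eq_top_iff]
      rintro m -
      rw [← sum_vertexProj (k := k) (Λ := Λ) m]
      refine Submodule.sum_mem _ fun z _ => ?_
      have hsup (v : (_root_.moduleToRep k Λ M).V z) : ∃ p ∈ P z, ∃ q ∈ Q z, p + q = v :=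
        Submodule.mem_sup.1 ((hPQ z).sup_eq_top ▸ Submodule.mem_top)
      obtain ⟨p, hp, q, hq, h⟩ := hsup (vertexProj Λ M z m)
      rw [← h]
      exact Submodule.add_mem_sup (coe_mem_submoduleOfStable hp) (coe_mem_submoduleOfStable hq)

/-- The linear map that is given by linear maps between the spaces at the vertices. -/
noncomputable def glueLinearMap (φ : ∀ z, vertexSpace k Λ M z →ₗ[k] vertexSpace k Λ N z) :
    M →ₗ[k] N :=
  ∑ z, (vertexSpace k Λ N z).subtype ∘ₗ φ z ∘ₗ vertexProj Λ M z

theorem glueLinearMap_apply (φ : ∀ z, vertexSpace k Λ M z →ₗ[k] vertexSpace k Λ N z) (m : M) :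
    glueLinearMap φ m = ∑ z, (φ z (vertexProj Λ M z m) : N) := by
  simp [glueLinearMap]

theorem vertexProj_glueLinearMap (φ : ∀ z, vertexSpace k Λ M z →ₗ[k] vertexSpace k Λ N z)
    (m : M) (z : Γ₀) :
    vertexProj Λ N z (glueLinearMap φ m) = φ z (vertexProj Λ M z m) := by
  rw [glueLinearMap_apply, map_sum, Finset.sum_eq_single z, vertexProj_coe_self]
  · exact fun y _ hy => vertexProj_coe_of_ne hy _
  · simp

theorem vertexProj_ext {m m' : M}
    (h : ∀ z, vertexProj (k := k) Λ M z m = vertexProj Λ M z m') : m = m' := by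
  rw [← sum_vertexProj (k := k) (Λ := Λ) m, ← sum_vertexProj (k := k) (Λ := Λ) m']
  simp only [h]

/-- Modules with isomorphic representations are isomorphic. -/
theorem nonempty_linearEquiv_of_equiv [FiniteDimensional k M] [FiniteDimensional k N]
    (φ : (moduleToRep k Λ M).Equiv (moduleToRep k Λ N)) :
    Nonempty (M ≃ₗ[PathAlgebra k Λ.Vert] N) := by
  let e (z : Γ₀) : vertexSpace k Λ M z ≃ₗ[k] vertexSpace k Λ N z := φ.equiv z
  have he (y z) (a : Γ₁) (hs : Λ.s a = y) (hz : Λ.e a = z) (v) :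
      e z (arrowMap k Λ M a hs hz v) = arrowMap k Λ N a hs hz (e y v) := φ.comm y z a hs hz v
  let f : M →ₗ[k] N := glueLinearMap fun z => (e z).toLinearMap
  let g : N →ₗ[k] M := glueLinearMap fun z => (e z).symm.toLinearMap
  have hf (m) (z) : vertexProj Λ N z (f m) = e z (vertexProj Λ M z m) :=
    vertexProj_glueLinearMap _ m z
  have hg (n) (z) : vertexProj Λ M z (g n) = (e z).symm (vertexProj Λ N z n) :=
    vertexProj_glueLinearMap _ n z
  refine ⟨{ toFun := f, invFun := g, map_add' := map_add f, map_smul' := fun a => ?_,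
            left_inv := fun m => vertexProj_ext (k := k) (Λ := Λ) fun z => by
              rw [hg, hf, LinearEquiv.symm_apply_apply]
            right_inv := fun n => vertexProj_ext (k := k) (Λ := Λ) fun z => by
              rw [hf, hg, LinearEquiv.apply_symm_apply] }⟩
  rw [RingHom.id_apply]
  -- Linearity over the path algebra reduces to generators: f respects the e_x by construction, and
  -- the arrows because φ commutes with them.
  induction a using PathAlgebra.generator_induction with
  | h0 => simp
  | hadd a b h h' => intro m; rw [add_smul, add_smul, map_add, h, h']
  | hsmul c a h => intro m; rw [smul_assoc, smul_assoc, map_smul, h]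
  | hmul a b h h' => intro m; rw [mul_smul, mul_smul, h, h']
  | hv x =>
    intro m
    refine vertexProj_ext (k := k) (Λ := Λ) fun z => ?_
    rw [hf, ← coe_vertexProj, ← coe_vertexProj]
    by_cases h : x = z
    · subst h
      rw [vertexProj_coe_self, vertexProj_coe_self, hf]
    · rw [vertexProj_coe_of_ne h, vertexProj_coe_of_ne h, map_zero]
  | ha x y a hs hy =>
    intro m
    refine vertexProj_ext (k := k) (Λ := Λ) fun z => ?_
    rw [hf]
    by_cases h : y = z
    · subst h
      rw [vertexProj_arrow_smul, vertexProj_arrow_smul, he, hf]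
    · rw [vertexProj_arrow_smul_of_ne _ _ _ h, vertexProj_arrow_smul_of_ne _ _ _ h, map_zero]

end Modules

theorem proposition4p2 {k : Type*} [Field k] {Γ₀ : Type*} [Fintype Γ₀] [Nontrivial Γ₀]
    {Γ₁ : Type} [Fintype Γ₁] (Λ : QuiverOrientation Γ₀ Γ₁)
    (hconn : Λ.IsConnected) (hacyc : Λ.IsAcyclic)
    (M : Type*) [AddCommGroup M] [Module k M] [Module (PathAlgebra k Λ.Vert) M]
    [IsScalarTower k (PathAlgebra k Λ.Vert) M] [FiniteDimensional k M]
    (N : Type*) [AddCommGroup N] [Module k N] [Module (PathAlgebra k Λ.Vert) N]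
    [IsScalarTower k (PathAlgebra k Λ.Vert) N] [FiniteDimensional k N]
    (hM : IsIndecomposableModule (PathAlgebra k Λ.Vert) M)
    (hN : IsIndecomposableModule (PathAlgebra k Λ.Vert) N)
    (hpre : IsPreprojectiveModule k Λ M)
    (hdim : dimVector k Λ M = dimVector k Λ N) :
    Nonempty (M ≃ₗ[PathAlgebra k Λ.Vert] N) := by
  obtain ⟨S, hS, h0⟩ := hpre
  obtain ⟨φ⟩ := QuiverRep.nonempty_equiv_of_isZero_reflectSeq S hS _ _ hM.moduleToRep
    hN.moduleToRep (congrFun hdim) h0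
  exact nonempty_linearEquiv_of_equiv φ
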